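/- All fields have characteristic zero. Let $(F_n,\sigma)$ be a $\Sigma^*$-tower over a difference field $(F_0,\sigma)$ with constant field $C$: $\sigma$ is a field automorphism of $F_n$ that restricts to an automorphism of $F_0$, and there are fields $F_0\le F_1\le\dots\le F_n$ such that, for $1\le i\le n$, $F_i=F_{i-1}(t_i)$ with $t_i$ transcendental over $F_{i-1}$ and $\Delta(t_i)\in F_{i-1}$, where $\Delta(f)=\sigma(f)-f$; moreover $\{f\in F_n:\sigma(f)=f\}=\{f\in F_0:\sigma(f)=f\}=C$. A complete reduction for $\Delta(F_i)$ on $F_i$ is a $C$-linear map $\phi:F_i\to F_i$ with $f-\phi(f)\in\Delta(F_i)$ for all $f\in F_i$ and $\ker\phi=\Delta(F_i)$. Complete reductions $\phi_0,\dots,\phi_n$ along the tower are fixed as follows. Let $\phi_0$ be any complete reduction for $\Delta(F_0)$ on $F_0$, and let $\Theta_0$ be any $C$-basis of $F_0$. For $i\ge1$ let $\Theta_i$ be the $F_{i-1}$-basis of $F_i$ that consists of all $t_i^k$ with $k\ge 0$ and all $t_i^k/q^j$ with $q\in F_{i-1}[t_i]$ monic irreducible, $0\le k<\deg q$, $j\ge1$.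 Let $\Xi_i=\{\vartheta_0\vartheta_1\cdots\vartheta_i : \vartheta_j\in\Theta_j\}$, a $C$-basis of $F_i$. For $\theta\in\Xi_i$ let $\theta^*:F_i\to C$ be the $C$-linear map with $\theta^*(\theta)=1$ that vanishes on $\Xi_i\setminus\{\theta\}$. For $f\in F_n$ put $\operatorname{ind}(f)=\min\{i: f\in F_i\}$. For $1\le i\le n$, given $\phi_{i-1}$, choose * an element $\theta_i\in\Xi_{i-1}$ with $\theta_i^*(\phi_{i-1}(\Delta(t_i)))\ne0$ and $\operatorname{ind}(\theta_i)=\operatorname{ind}(\phi_{i-1}(\Delta(t_i)))$; * a set $S_i$ of representatives of the monic irreducible polynomials of $F_{i-1}[t_i]$ under the equivalence relation $p\sim q \iff p=c\,\sigma^{\ell}(q)$ for some $c\in F_{i-1}\setminus\{0\}$ and $\ell\in\mathbb Z$. Let $U_i$ be the set of all $a/d$ with $a\in F_{i-1}[t_i]$, $d$ a finite (possibly empty) product of elements of $S_i$, and $\deg a<\deg d$ (where $\deg 0=-\infty$). Let $V_i=\bigoplus_{k\ge0}\bigl(\operatorname{im}(\phi_{i-1})\cap\ker\theta_i^*\bigr)t_i^k$.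 Then $\phi_i$ is the complete reduction for $\Delta(F_i)$ on $F_i$ with image $U_i\oplus V_i$, that is, the projection onto $U_i\oplus V_i$ along $\Delta(F_i)$ in $F_i=\Delta(F_i)\oplus U_i\oplus V_i$. The tower is called well generated (with respect to these choices) if $\Delta(t_i)\in\operatorname{im}(\phi_{i-1})$ for all $1\le i\le n$. **Lemma.** Every well generated $\Sigma^*$-tower $(F_n,\sigma)$ over $(F_0,\sigma)$ is reduced over $F_0$: for every $1\le i\le n$, if there are $g_i\in F_{i-1}$ and $r_i\in F_0$ with $\Delta(t_i)=\Delta(g_i)+r_i$, then $\Delta(t_i)\in F_0$. -/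

import Mathlib

open scoped Polynomial IntermediateField

namespace SigmaTower

section LinearAlgebra

variable {R V : Type*} [Field R] [AddCommGroup V] [Module R V]

/-- A linear operator `φ` on `V` is a complete reduction for the subspace `U` if
`f - φ f ∈ U` for all `f`, and `ker φ = U`. -/
structure IsCompleteReduction (U : Submodule R V) (φ : V →ₗ[R] V) : Prop where
  sub_mem : ∀ f : V, f - φ f ∈ U
  ker_eq : LinearMap.ker φ = U

open Classical in
/-- The dual functional `θ^*` of a member `θ` of a basis `B` of `V`: the linear map with
`θ^* θ = 1` and `θ^* b = 0` for every other `b ∈ B`. (If `B` is a basis, there is exactly one such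
map; the value `0` is used only if there is none.) -/
noncomputable def dualFunctional (B : Set V) (θ : V) : V →ₗ[R] R :=
  if h : ∃ L : V →ₗ[R] R, ∀ b ∈ B, L b = if b = θ then 1 else 0 then h.choose else 0

end LinearAlgebra

variable {C E : Type*} [Field C] [Field E] [Algebra C E]

/-- The difference operator `Δ f = σ f - f`. -/
def delta (σ : E ≃ₐ[C] E) : E →ₗ[C] E := σ.toLinearMap - LinearMap.id

/-- The summable space `Δ(K)` of a subfield `K` with `σ(K) = K`, as a `C`-subspace of `K`. -/
def summableSpace (σ : E ≃ₐ[C] E) (K : IntermediateField C E) : Submodule C K :=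
  (K.toSubalgebra.toSubmodule.map (delta σ)).comap K.val.toLinearMap

/-- The fields `F_0 ≤ F_1 ≤ F_2 ≤ ⋯` with `F_{i+1} = F_i(t_i)`. The generators are numbered from
`0`, so that `t i` is a generator of `F_{i+1}` over `F_i`. -/
def towerField (F₀ : IntermediateField C E) (t : ℕ → E) : ℕ → IntermediateField C E
  | 0 => F₀
  | i + 1 => IntermediateField.restrictScalars C ((towerField F₀ t i)⟮t i⟯)

/-- `(E, σ)` is the `Σ^*`-tower `F_0(t_0, …, t_{n-1})` over the difference field `(F_0, σ)`, with
constant field `C`. The constants of `C ⊆ F_0` are fixed by `σ` because `σ` is `C`-linear. -/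
structure IsSigmaTower (σ : E ≃ₐ[C] E) (F₀ : IntermediateField C E) (t : ℕ → E) (n : ℕ) :
    Prop where
  base_stable : ∀ x : E, σ x ∈ F₀ ↔ x ∈ F₀
  top_eq : towerField F₀ t n = ⊤
  transcendental : ∀ i < n, Transcendental (towerField F₀ t i) (t i)
  delta_mem : ∀ i < n, delta σ (t i) ∈ towerField F₀ t i
  const_mem : ∀ x : E, σ x = x → x ∈ Set.range (algebraMap C E)

/-- `ind f = min {i | f ∈ F_i}`. -/
noncomputable def ind (F₀ : IntermediateField C E) (t : ℕ → E) (f : E) : ℕ :=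
  sInf {i : ℕ | f ∈ towerField F₀ t i}

/-- The canonical `K`-basis of `K(t)` for `t` transcendental over `K`: the powers `t^k`, and the
fractions `t^k / q^j` with `q ∈ K[t]` monic irreducible, `k < deg q` and `j ≥ 1`. -/
def fractionBasis (K : IntermediateField C E) (t : E) : Set E :=
  {x | ∃ k : ℕ, x = t ^ k} ∪
  {x | ∃ (q : K[X]) (k j : ℕ), q.Monic ∧ Irreducible q ∧ k < q.natDegree ∧ 0 < j ∧
    x = t ^ k / Polynomial.aeval t q ^ j}

/-- The canonical `C`-basis of `F_i` that belongs to a `C`-basis `Θ₀` of `F_0`: all products of a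
member of `Θ₀` and one member each of the canonical `F_j`-bases of `F_{j+1} = F_j(t_j)`, `j < i`. -/
def canonicalBasis {ι : Type*} {F₀ : IntermediateField C E} (Θ₀ : Module.Basis ι C F₀)
    (t : ℕ → E) : ℕ → Set E
  | 0 => Set.range fun j : ι => (Θ₀ j : E)
  | i + 1 => {x | ∃ ξ ∈ canonicalBasis Θ₀ t i,
      ∃ η ∈ fractionBasis (towerField F₀ t i) (t i), x = ξ * η}

/-- The `C`-linear functional `θ^* : F_i → C` for a member `θ` of the canonical basis of `F_i`. -/
noncomputable def thetaStar {ι : Type*} {F₀ : IntermediateField C E} (Θ₀ : Module.Basis ι C F₀)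
    (t : ℕ → E) (i : ℕ) (θ : towerField F₀ t i) : towerField F₀ t i →ₗ[C] C :=
  dualFunctional {ξ : towerField F₀ t i | (ξ : E) ∈ canonicalBasis Θ₀ t i} θ

/-- `p, q ∈ K[t]` are `σ`-equivalent: `p = c σ^ℓ(q)` with `c ∈ K` nonzero and `ℓ` an integer. -/
def SigmaEquivalent (σ : E ≃ₐ[C] E) (K : IntermediateField C E) (t : E) (p q : K[X]) : Prop :=
  ∃ (c : K) (l : ℤ), c ≠ 0 ∧
    Polynomial.aeval t p = (c : E) * (σ ^ l) (Polynomial.aeval t q)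

/-- `S` is a set of representatives of the `σ`-equivalence classes on the set of all monic
irreducible polynomials of `K[t]`. -/
structure IsRepresentativeSet (σ : E ≃ₐ[C] E) (K : IntermediateField C E) (t : E)
    (S : Set K[X]) : Prop where
  monic_irreducible : ∀ p ∈ S, p.Monic ∧ Irreducible p
  existsUnique : ∀ q : K[X], q.Monic → Irreducible q → ∃! p, p ∈ S ∧ SigmaEquivalent σ K t p q

/-- `U_S`: the `t`-proper elements `a / d` of `K(t)` whose denominator `d` is a (possibly empty)
product of members of `S`. -/
def properComplement (K : IntermediateField C E) (t : E) (S : Set K[X]) : Set E :=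
  {x | ∃ a d : K[X], d ∈ Submonoid.closure S ∧ a.degree < d.degree ∧
    x = Polynomial.aeval t a / Polynomial.aeval t d}

/-- `V_θ`: the polynomials in `t` with all coefficients in `im φ ∩ ker θ^*`; here `L = θ^*`. -/
def polyComplement (K : IntermediateField C E) (t : E) (φ : K →ₗ[C] K) (L : K →ₗ[C] C) : Set E :=
  {x | ∃ p : K[X], (∀ k : ℕ, p.coeff k ∈ LinearMap.range φ ∧ L (p.coeff k) = 0) ∧
    x = Polynomial.aeval t p}

/-- `φ 0, …, φ n` are the complete reductions on `F_0, …, F_n` that are constructed recursively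
along the tower. `φ 0` is any complete reduction for `Δ(F_0)`. Given `φ i`, choose a member `θ i` of
the canonical basis of `F_i` that is effective for `φ i (Δ t_i)` and has the same index, and a set
`S i` of representatives of the monic irreducible polynomials of `F_i[t_i]`; then `φ (i+1)` is the
complete reduction for `Δ(F_{i+1})` that belongs to the decomposition
`F_{i+1} = Δ(F_{i+1}) ⊕ U_S ⊕ V_θ`. -/
structure IsReductionSystem {ι : Type*} (σ : E ≃ₐ[C] E) (F₀ : IntermediateField C E) (t : ℕ → E)
    (n : ℕ) (Θ₀ : Module.Basis ι C F₀) (S : ∀ i : ℕ, Set (towerField F₀ t i)[X])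
    (θ : ∀ i : ℕ, towerField F₀ t i)
    (φ : ∀ i : ℕ, towerField F₀ t i →ₗ[C] towerField F₀ t i) : Prop where
  completeReduction : ∀ i ≤ n, IsCompleteReduction (summableSpace σ (towerField F₀ t i)) (φ i)
  representatives : ∀ i < n, IsRepresentativeSet σ (towerField F₀ t i) (t i) (S i)
  theta_mem : ∀ i < n, (θ i : E) ∈ canonicalBasis Θ₀ t i
  theta_effective : ∀ i < n, ∀ a : towerField F₀ t i, (a : E) = delta σ (t i) →
    thetaStar Θ₀ t i (θ i) (φ i a) ≠ 0
  theta_ind : ∀ i < n, ∀ a : towerField F₀ t i, (a : E) = delta σ (t i) →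
    ind F₀ t (θ i) = ind F₀ t (φ i a)
  range_succ : ∀ i < n, ∀ x : towerField F₀ t (i + 1), x ∈ LinearMap.range (φ (i + 1)) ↔
    ∃ u ∈ properComplement (towerField F₀ t i) (t i) (S i),
      ∃ v ∈ polyComplement (towerField F₀ t i) (t i) (φ i) (thetaStar Θ₀ t i (θ i)),
        (x : E) = u + v

/-- The tower is well generated with respect to `φ`: `Δ(t_i) ∈ im (φ i)` for each `i < n`. -/
def IsWellGenerated (σ : E ≃ₐ[C] E) (F₀ : IntermediateField C E) (t : ℕ → E) (n : ℕ)
    (φ : ∀ i : ℕ, towerField F₀ t i →ₗ[C] towerField F₀ t i) : Prop :=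
  ∀ i < n, ∃ y ∈ LinearMap.range (φ i), (y : E) = delta σ (t i)

/-- The tower is reduced over `F_0`. -/
def IsReduced (σ : E ≃ₐ[C] E) (F₀ : IntermediateField C E) (t : ℕ → E) (n : ℕ) : Prop :=
  ∀ i < n, (∃ g ∈ towerField F₀ t i, ∃ r ∈ F₀, delta σ (t i) = delta σ g + r) →
    delta σ (t i) ∈ F₀

end SigmaTower

namespace SigmaTower

section LinearAlgebra

variable {R V : Type*} [Field R] [AddCommGroup V] [Module R V]

/-! If `Δ(t_i) = Δ(g) + r`, applying `φ_i` kills `Δ(g)` and fixes `Δ(t_i)`, which lies in `im φ_i`;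
so `Δ(t_i) = φ_i(r)`. It remains to see that `φ_i` preserves `F_0` (`apply_mem_base`). By induction,
`φ_{i+1}(r) = f - c Δ(t_i)` with `f = φ_i(r) ∈ F_0` and `c` chosen to put the difference in `ker
θ_i^*`. If `Δ(t_i) ∉ F_0`, the index condition forces `θ_i ∉ F_0`; then `θ_i^*` vanishes on `F_0`
and `c = 0`. -/

theorem dualFunctional_apply_of_ne {B : Set V} {θ b : V} (hb : b ∈ B) (hne : b ≠ θ) :
    dualFunctional (R := R) B θ b = 0 := by
  classical
  unfold dualFunctional
  split_ifs with h
  · have := h.choose_spec b hb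
    rwa [if_neg hne] at this
  -- The default value 0 also vanishes at `b`, so `B` need not be shown to be a basis.
  · rfl

theorem IsCompleteReduction.apply_eq_of_sub_mem {U : Submodule R V} {φ : V →ₗ[R] V}
    (h : IsCompleteReduction U φ) {f g : V} (hfg : f - g ∈ U) : φ f = φ g := by
  rw [← h.ker_eq, LinearMap.mem_ker, map_sub] at hfg
  exact sub_eq_zero.mp hfg

theorem IsCompleteReduction.apply_of_mem_range {U : Submodule R V} {φ : V →ₗ[R] V}
    (h : IsCompleteReduction U φ) {f : V} (hf : f ∈ LinearMap.range φ) : φ f = f := by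
  obtain ⟨g, rfl⟩ := hf
  exact (h.apply_eq_of_sub_mem (h.sub_mem g)).symm

end LinearAlgebra

section Tower

variable {C E : Type*} [Field C] [Field E] [Algebra C E]

theorem mem_summableSpace {σ : E ≃ₐ[C] E} {K : IntermediateField C E} {x : K} :
    x ∈ summableSpace σ K ↔ ∃ y ∈ K, delta σ y = x :=
  Iff.rfl

variable {F₀ : IntermediateField C E} {t : ℕ → E}

theorem towerField_le_succ (i : ℕ) : towerField F₀ t i ≤ towerField F₀ t (i + 1) := fun x hx =>
  (IntermediateField.adjoin (towerField F₀ t i) {t i}).algebraMap_mem ⟨x, hx⟩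

theorem generator_mem_towerField_succ (i : ℕ) : t i ∈ towerField F₀ t (i + 1) :=
  IntermediateField.mem_adjoin_simple_self (towerField F₀ t i) (t i)

theorem base_le_towerField (i : ℕ) : F₀ ≤ towerField F₀ t i := by
  induction i with
  | zero => exact le_rfl
  | succ i ih => exact ih.trans (towerField_le_succ i)

/-- Membership in some `F_i` excludes the junk value `sInf ∅ = 0`. -/
theorem ind_eq_zero_iff {f : E} {i : ℕ} (hf : f ∈ towerField F₀ t i) :
    ind F₀ t f = 0 ↔ f ∈ F₀ := by
  unfold ind
  rw [Nat.sInf_eq_zero]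
  refine ⟨?_, Or.inl⟩
  rintro (h | h)
  · exact h
  · exact absurd (h ▸ hf : i ∈ (∅ : Set ℕ)) (Set.notMem_empty i)

theorem one_mem_fractionBasis (K : IntermediateField C E) (s : E) : (1 : E) ∈ fractionBasis K s :=
  Or.inl ⟨0, (pow_zero s).symm⟩

theorem base_mem_canonicalBasis {ι : Type*} (Θ₀ : Module.Basis ι C F₀) (j : ι) (i : ℕ) :
    (Θ₀ j : E) ∈ canonicalBasis Θ₀ t i := by
  induction i with
  | zero => exact ⟨j, rfl⟩
  | succ i ih => exact ⟨_, ih, 1, one_mem_fractionBasis _ _, (mul_one _).symm⟩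

/-- If `θ ∉ F_0`, then `θ^*` vanishes on `F_0`. -/
theorem thetaStar_apply_of_mem_base {ι : Type*} (Θ₀ : Module.Basis ι C F₀) {i : ℕ}
    {θ : towerField F₀ t i} (hθ : (θ : E) ∉ F₀) {f : towerField F₀ t i} (hf : (f : E) ∈ F₀) :
    thetaStar Θ₀ t i θ f = 0 := by
  have key : (thetaStar Θ₀ t i θ).comp
      (IntermediateField.inclusion (base_le_towerField i)).toLinearMap = 0 := by
    -- It suffices to test on `Θ₀`: its members belong to the canonical basis of `F_i` and, lying in
    -- `F_0`, differ from `θ`.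
    refine Θ₀.ext fun j => ?_
    refine dualFunctional_apply_of_ne (base_mem_canonicalBasis Θ₀ j i) fun h => hθ ?_
    rw [← h]
    exact (Θ₀ j).2
  exact LinearMap.congr_fun key ⟨f, hf⟩

variable {σ : E ≃ₐ[C] E} {n : ℕ} {ι : Type*} {Θ₀ : Module.Basis ι C F₀}
  {S : ∀ i : ℕ, Set (Polynomial (towerField F₀ t i))} {θ : ∀ i : ℕ, towerField F₀ t i}
  {φ : ∀ i : ℕ, towerField F₀ t i →ₗ[C] towerField F₀ t i}

/-- Elements of `im φ_i ∩ ker θ_i^*` are fixed by `φ_{i+1}`. -/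
theorem IsReductionSystem.apply_succ_eq_self (hφ : IsReductionSystem σ F₀ t n Θ₀ S θ φ) {i : ℕ}
    (hi : i < n) {v : towerField F₀ t i} (hv : v ∈ LinearMap.range (φ i))
    (hv0 : thetaStar Θ₀ t i (θ i) v = 0) :
    φ (i + 1) ⟨v, towerField_le_succ i v.2⟩ = ⟨v, towerField_le_succ i v.2⟩ := by
  refine (hφ.completeReduction (i + 1) hi).apply_of_mem_range ((hφ.range_succ i hi _).2 ?_)
  -- The proper part is `0/1`, with the empty product as denominator; the polynomial part is the
  -- constant `v`.
  refine ⟨0, ⟨0, 1, one_mem _, by simp, by simp⟩, v, ⟨Polynomial.C v, fun k => ?_, ?_⟩, ?_⟩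
  · rw [Polynomial.coeff_C]
    split_ifs
    · exact ⟨hv, hv0⟩
    · exact ⟨zero_mem _, map_zero _⟩
  · exact (Polynomial.aeval_C (t i) v).symm
  · exact (zero_add _).symm

/-- In a well generated tower every `φ_i` maps `F_0` into itself. -/
theorem IsReductionSystem.apply_mem_base
    (hφ : IsReductionSystem σ F₀ t n Θ₀ S θ φ) (hW : IsWellGenerated σ F₀ t n φ) {i : ℕ}
    (hi : i ≤ n) (r : E) (hr : r ∈ F₀) : (φ i ⟨r, base_le_towerField i hr⟩ : E) ∈ F₀ := by
  induction i with
  | zero => exact (φ 0 _).2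
  | succ i ih =>
    have hin : i < n := hi
    have hred := hφ.completeReduction i hin.le
    obtain ⟨a, ha, hat⟩ := hW i hin
    have haφ : φ i a = a := hred.apply_of_mem_range ha
    set L := thetaStar Θ₀ t i (θ i) with hL
    have hLa : L a ≠ 0 := haφ ▸ hφ.theta_effective i hin a hat
    set f := φ i ⟨r, base_le_towerField i hr⟩ with hf
    have hf0 : (f : E) ∈ F₀ := ih hin.le
    -- The unique scalar with `L (f - c • a) = 0`.
    set c : C := L f / L a with hc
    have hca : (c • a : E) ∈ F₀ := by
      by_cases ha0 : (a : E) ∈ F₀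
      · exact F₀.smul_mem ha0
      · have hθ : (θ i : E) ∉ F₀ := by
          rwa [← ind_eq_zero_iff (θ i).2, hφ.theta_ind i hin a hat, haφ, ind_eq_zero_iff a.2]
        have hLf : L f = 0 := thetaStar_apply_of_mem_base Θ₀ hθ hf0
        rw [hc, hLf, zero_div, zero_smul]
        exact zero_mem _
    have hvr : f - c • a ∈ LinearMap.range (φ i) :=
      sub_mem ⟨_, rfl⟩ (Submodule.smul_mem _ c ha)
    have hv0 : L (f - c • a) = 0 := by
      rw [map_sub, map_smul, smul_eq_mul, hc, div_mul_cancel₀ _ hLa, sub_self]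
    have hfix := hφ.apply_succ_eq_self hin hvr hv0
    obtain ⟨g, hg, hgr⟩ := mem_summableSpace.1 (hred.sub_mem ⟨r, base_le_towerField i hr⟩)
    have hgr' : delta σ g = r - f := hgr
    have hsub : (⟨r, base_le_towerField (i + 1) hr⟩ : towerField F₀ t (i + 1)) -
        ⟨(f - c • a : towerField F₀ t i), towerField_le_succ i (f - c • a).2⟩ ∈
          summableSpace σ (towerField F₀ t (i + 1)) := by
      -- Adjoining `t_i` makes `a = Δ(t_i)` summable, so `r` and `f - c • a` agree modulo
      -- `Δ(F_{i+1})`.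
      refine mem_summableSpace.2 ⟨g + c • t i, add_mem (towerField_le_succ i hg)
        ((towerField F₀ t (i + 1)).smul_mem (generator_mem_towerField_succ i)), ?_⟩
      rw [map_add, map_smul, hgr', ← hat]
      change r - (f : E) + c • (a : E) = r - ((f : E) - c • (a : E))
      ring
    rw [(hφ.completeReduction (i + 1) hi).apply_eq_of_sub_mem hsub, hfix]
    exact sub_mem hf0 hca

end Tower

end SigmaTower

theorem mainTheorem10 {C E ι : Type*} [Field C] [CharZero C] [Field E] [Algebra C E]
    (σ : E ≃ₐ[C] E) (F₀ : IntermediateField C E) (n : ℕ) (t : ℕ → E)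
    (hT : SigmaTower.IsSigmaTower σ F₀ t n)
    (Θ₀ : Module.Basis ι C F₀)
    (S : ∀ i : ℕ, Set (Polynomial (SigmaTower.towerField F₀ t i)))
    (θ : ∀ i : ℕ, SigmaTower.towerField F₀ t i)
    (φ : ∀ i : ℕ, SigmaTower.towerField F₀ t i →ₗ[C] SigmaTower.towerField F₀ t i)
    (hφ : SigmaTower.IsReductionSystem σ F₀ t n Θ₀ S θ φ)
    (hW : SigmaTower.IsWellGenerated σ F₀ t n φ) :
    SigmaTower.IsReduced σ F₀ t n := by
  rintro i hi ⟨g, hg, r, hr, hgr⟩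
  obtain ⟨a, ha, hat⟩ := hW i hi
  have hred := hφ.completeReduction i hi.le
  have hsub : a - ⟨r, SigmaTower.base_le_towerField i hr⟩ ∈
      SigmaTower.summableSpace σ (SigmaTower.towerField F₀ t i) := by
    refine SigmaTower.mem_summableSpace.2 ⟨g, hg, ?_⟩
    change _ = (a : E) - r
    rw [hat, hgr, add_sub_cancel_right]
  rw [← hat, ← hred.apply_of_mem_range ha, hred.apply_eq_of_sub_mem hsub]
  exact hφ.apply_mem_base hW hi.le r hr
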